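/- Proposition 1 (Kailath & Weinert). Fix a coherence time $K$, a number of transmit antennas $N_{\mathrm t}$, an alphabet $\mathcal S=\{\mathbf S_1,\dots,\mathbf S_M\}\subset\mathbb C^{K\times N_{\mathrm t}}$ of $M$ distinct codewords with $\frac1K\cdot\frac1M\sum_{i}\|\mathbf S_i\|_{\mathrm F}^2=1$, a transmitted power $P_X>0$ and a noise power $P_Z$, and put $\mathbf X_i=\sqrt{P_X}\,\mathbf S_i$. For every number $N_{\mathrm r}\ge 1$ of receive antennas let the received signal be $\mathsf Y=\mathsf X\mathsf H+\mathsf Z\in\mathbb C^{K\times N_{\mathrm r}}$, where $\mathsf X$ is uniformly distributed on $\{\mathbf X_1,\dots,\mathbf X_M\}$, the channel satisfies $\operatorname{vec}(\mathsf H)\sim\mathcal{CN}(\mathbf 0,\mathbf C_{\mathbf h})$ with $\mathbf C_{\mathbf h}$ positive semidefinite, the noise satisfies $\operatorname{vec}(\mathsf Z)\sim\mathcal{CN}(\mathbf 0,\mathbf C_{\mathbf z})$ with $\mathbf C_{\mathbf z}$ positive definite, and $\mathsf X,\mathsf H,\mathsf Z$ are independent, with $\mathbb E\|\mathsf H\|_{\mathrm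 F}^2=1$ and $\frac1K\mathbb E\|\mathsf Z\|_{\mathrm F}^2=P_Z$ (the covariance matrices may depend arbitrarily on $N_{\mathrm r}$ otherwise). Let $\mathbf C_i=(\mathbf I_{N_{\mathrm r}}\otimes\mathbf X_i)\mathbf C_{\mathbf h}(\mathbf I_{N_{\mathrm r}}\otimes\mathbf X_i)^{\mathrm H}+\mathbf C_{\mathbf z}$ be the covariance matrix of $\mathbf y=\operatorname{vec}(\mathsf Y)$ given $\mathbf S_i$, let $f_i(\mathbf y)=\pi^{-KN_{\mathrm r}}|\mathbf C_i|^{-1}e^{-\mathbf y^{\mathrm H}\mathbf C_i^{-1}\mathbf y}$ be the corresponding likelihood, and let $\mathrm P_{\mathrm e}$ be the probability that a maximum likelihood detector (a measurable choice of a maximizer of $i\mapsto f_i(\mathbf y)$, with any resolution of ties) does not return the transmitted codeword. For codewords $a,b$ let $$\mathrm J_{N_{\mathrm r}}(a,b)=\mathbb E\Bigl[\ln\tfrac{f_a(\mathbf y)}{f_b(\mathbf y)}\,\Big|\,\mathbf S_a\Bigr]-\mathbb E\Bigl[\ln\tfrac{f_a(\mathbf y)}{f_b(\mathbf y)}\,\Big|\,\mathbf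 S_b\Bigr]$$ be the Jeffreys divergence between the two Gaussian hypotheses. Then both expectations are finite and $\mathrm J_{N_{\mathrm r}}(a,b)=\operatorname{tr}\{(\mathbf C_b^{-1}-\mathbf C_a^{-1})(\mathbf C_a-\mathbf C_b)\}$ for every $N_{\mathrm r}\ge1$, and $$\lim_{N_{\mathrm r}\to\infty}\mathrm P_{\mathrm e}=0\quad\Longleftrightarrow\quad \lim_{N_{\mathrm r}\to\infty}\mathrm J_{N_{\mathrm r}}(a,b)=\infty\ \text{ for all } a\neq b .$$ -/

import Mathlib

open MeasureTheory ProbabilityTheory Filter Topology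
open scoped Matrix Kronecker ComplexOrder

noncomputable section

/-- `μ` is the circularly symmetric complex normal law `𝒞𝒩(0, C)` on `ℂ^ι` (`C` positive
semidefinite, possibly singular), given by its characteristic function
`E[exp (i Re (tᴴ x))] = exp (-(tᴴ C t) / 4)`. -/
def IsComplexNormal {ι : Type*} [Fintype ι] (C : Matrix ι ι ℂ) (μ : Measure (ι → ℂ)) : Prop :=
  C.PosSemidef ∧ IsProbabilityMeasure μ ∧
    ∀ t : ι → ℂ, ∫ x, Complex.exp (Complex.I * ((star t ⬝ᵥ x).re : ℂ)) ∂μ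
      = Complex.exp (-(star t ⬝ᵥ (C *ᵥ t)) / 4)

/-- The density `y ↦ exp (-yᴴ C⁻¹ y) / (π ^ n |C|)` of `𝒞𝒩(0, C)` on `ℂⁿ`, for `C` positive
definite (so that the determinant and the quadratic form are real). -/
def complexNormalPDF {ι : Type*} [Fintype ι] [DecidableEq ι] (C : Matrix ι ι ℂ)
    (y : ι → ℂ) : ℝ :=
  1 / (Real.pi ^ Fintype.card ι * C.det.re) * Real.exp (-(star y ⬝ᵥ (C⁻¹ *ᵥ y)).re)

/-- Squared Frobenius norm. -/
def frobSq {m n : Type*} [Fintype m] [Fintype n] (A : Matrix m n ℂ) : ℝ :=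
  ∑ r, ∑ c, ‖A r c‖ ^ 2

/-- The transmitted signal `X = √P_X S`. -/
def txSignal {K Nt : ℕ} (PX : ℝ) (S : Matrix (Fin K) (Fin Nt) ℂ) : Matrix (Fin K) (Fin Nt) ℂ :=
  ((Real.sqrt PX : ℝ) : ℂ) • S

/-- Covariance matrix `(I ⊗ X) C_h (I ⊗ X)ᴴ + C_z` of the vectorized received signal, given that
`X` was transmitted. -/
def rxCov {K Nt N : ℕ} (X : Matrix (Fin K) (Fin Nt) ℂ)
    (Ch : Matrix (Fin N × Fin Nt) (Fin N × Fin Nt) ℂ)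
    (Cz : Matrix (Fin N × Fin K) (Fin N × Fin K) ℂ) :
    Matrix (Fin N × Fin K) (Fin N × Fin K) ℂ :=
  ((1 : Matrix (Fin N) (Fin N) ℂ) ⊗ₖ X) * Ch * ((1 : Matrix (Fin N) (Fin N) ℂ) ⊗ₖ X)ᴴ + Cz

/-- The vectorized received signal `vec (X H + Z)`, with `X` the signal of the random message. -/
def rxSignal {Ω : Type*} {K Nt N M : ℕ} (X : Fin M → Matrix (Fin K) (Fin Nt) ℂ)
    (msg : Ω → Fin M) (H : Ω → Matrix (Fin Nt) (Fin N) ℂ) (Z : Ω → Matrix (Fin K) (Fin N) ℂ)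
    (ω : Ω) : Fin N × Fin K → ℂ :=
  Matrix.vec (X (msg ω) * H ω + Z ω)

/-- The block-fading channel with `N` receive antennas: an equiprobable message `msg`, a channel
matrix `H` (correlated Rayleigh fading) and Gaussian noise `Z` with full-rank covariance,
all independent, with the normalizations `E‖H‖² = 1` and `E‖Z‖² / K = P_Z`. -/
structure IsFadingChannel {Ω : Type*} [MeasurableSpace Ω] {K Nt N M : ℕ} (P : Measure Ω)
    (msg : Ω → Fin M) (H : Ω → Matrix (Fin Nt) (Fin N) ℂ) (Z : Ω → Matrix (Fin K) (Fin N) ℂ)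
    (Ch : Matrix (Fin N × Fin Nt) (Fin N × Fin Nt) ℂ)
    (Cz : Matrix (Fin N × Fin K) (Fin N × Fin K) ℂ) (PZ : ℝ) : Prop where
  measurable_msg : Measurable msg
  measurable_H : Measurable fun ω => Matrix.vec (H ω)
  measurable_Z : Measurable fun ω => Matrix.vec (Z ω)
  equiprobable : ∀ a, P.real (msg ⁻¹' {a}) = 1 / M
  law_H : IsComplexNormal Ch (P.map fun ω => Matrix.vec (H ω))
  law_Z : IsComplexNormal Cz (P.map fun ω => Matrix.vec (Z ω))
  posDef_Cz : Cz.PosDef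
  indep_H_Z : IndepFun (fun ω => Matrix.vec (H ω)) (fun ω => Matrix.vec (Z ω)) P
  indep_msg : IndepFun msg (fun ω => (Matrix.vec (H ω), Matrix.vec (Z ω))) P
  power_H : ∫ ω, frobSq (H ω) ∂P = 1
  power_Z : 1 / (K : ℝ) * ∫ ω, frobSq (Z ω) ∂P = PZ

/-- `d` is a maximum likelihood detector for the zero-mean complex normal hypotheses with
covariance matrices `C a`: a measurable selection from the maximizers of the likelihood,
with an arbitrary resolution of ties. -/
def IsMLDetector {ι : Type*} [Fintype ι] [DecidableEq ι] {M : ℕ} (C : Fin M → Matrix ι ι ℂ)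
    (d : (ι → ℂ) → Fin M) : Prop :=
  Measurable d ∧ ∀ y a, complexNormalPDF (C a) y ≤ complexNormalPDF (C (d y)) y

/-- Probability that the detector `d`, applied to the received signal `y`, misses the message. -/
def errorProb {Ω ι : Type*} [MeasurableSpace Ω] {M : ℕ} (P : Measure Ω) (msg : Ω → Fin M)
    (y : Ω → ι → ℂ) (d : (ι → ℂ) → Fin M) : ℝ :=
  P.real {ω | d (y ω) ≠ msg ω}

/-- Log-likelihood ratio of `𝒞𝒩(0, Ca)` against `𝒞𝒩(0, Cb)`. -/
def logLR {ι : Type*} [Fintype ι] [DecidableEq ι] (Ca Cb : Matrix ι ι ℂ) (y : ι → ℂ) : ℝ :=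
  Real.log (complexNormalPDF Ca y / complexNormalPDF Cb y)

/-- Jeffreys divergence `E[L_{a,b}(y) | a] - E[L_{a,b}(y) | b]` between the laws of the received
signal `y` given the messages `a` and `b`, with `L_{a,b}` the log-likelihood ratio. -/
def jeffreysDiv {Ω ι : Type*} [MeasurableSpace Ω] [Fintype ι] [DecidableEq ι] {M : ℕ}
    (P : Measure Ω) (msg : Ω → Fin M) (y : Ω → ι → ℂ) (C : Fin M → Matrix ι ι ℂ)
    (a b : Fin M) : ℝ :=
  (∫ ω, logLR (C a) (C b) (y ω) ∂(cond P (msg ⁻¹' {a})))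
    - ∫ ω, logLR (C a) (C b) (y ω) ∂(cond P (msg ⁻¹' {b}))

end

/-! The Bhattacharyya coefficient `ρ = ∫ √(f_a f_b)` of two hypotheses mediates between error
probability and Jeffreys divergence `J`. A congruence by `T` turns the two covariances into
`diag(v)` and `1`, so both laws become products of scalar circular Gaussians. Then `ρ = ∏ 2√v/(1+v)`
and `J = ∑ (v + 1/v - 2)`, and each factor of `ρ⁻²` is exactly `1 + j/4`, with `j` the matching term
of `J`. Hence `1 + J/4 ≤ ρ⁻² ≤ exp (J/4)`. These bounds do not involve the dimension, which grows
with the number of antennas, so `ρ → 0` exactly when `J → ∞`.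

If every `J → ∞`, then each pairwise error is at most `ρ → 0`, and a union bound over the fixed
finite alphabet concludes. Conversely, a test with total error `ε` forces `2ρ ≤ cε + 2/c` for all `c
> 0`. Vanishing error thus gives `ρ → 0`, whatever the detector. Both halves rest on
`exists_jeffreys_affinity`; `IsFadingChannel.isComplexNormal_rxSignal` brings the channel into its
scope. -/

/-! ### Scalar circular Gaussians -/

/-- The density of the one-dimensional circular complex normal law of variance `v`. -/
noncomputable def cGaussDensity (v : ℝ) (z : ℂ) : ℝ := 1 / (Real.pi * v) * Real.exp (-‖z‖ ^ 2 / v)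

/-- The circular complex normal law of variance `v` on `ℂ`. -/
noncomputable def cGauss (v : ℝ) : Measure ℂ :=
  volume.withDensity fun z => ENNReal.ofReal (cGaussDensity v z)

/-- The likelihood ratio of `cGauss v` against `cGauss 1`. -/
noncomputable def cGaussRatio (v : ℝ) (z : ℂ) : ℝ := 1 / v * Real.exp (‖z‖ ^ 2 - ‖z‖ ^ 2 / v)

lemma measurable_cGaussDensity (v : ℝ) : Measurable (cGaussDensity v) := by
  unfold cGaussDensity; fun_prop

lemma measurable_cGaussRatio (v : ℝ) : Measurable (cGaussRatio v) := by
  unfold cGaussRatio; fun_prop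

lemma cGaussDensity_nonneg {v : ℝ} (hv : 0 < v) (z : ℂ) : 0 ≤ cGaussDensity v z := by
  unfold cGaussDensity; positivity

lemma cGaussRatio_pos {v : ℝ} (hv : 0 < v) (z : ℂ) : 0 < cGaussRatio v z := by
  unfold cGaussRatio; positivity

lemma integral_exp_neg_mul_sq_complex {b : ℝ} (hb : 0 < b) :
    ∫ z : ℂ, Real.exp (-b * ‖z‖ ^ 2) = Real.pi / b := by
  have := GaussianFourier.integral_rexp_neg_mul_sq_norm (V := ℂ) hb
  simpa [Complex.finrank_real_complex] using this

lemma integrable_exp_neg_mul_sq_complex {b : ℝ} (hb : 0 < b) :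
    Integrable fun z : ℂ => Real.exp (-b * ‖z‖ ^ 2) := by
  -- The Bochner integral of a non-integrable function is 0 by convention, so a nonzero value proves
  -- integrability.
  refine Integrable.of_integral_ne_zero ?_
  rw [integral_exp_neg_mul_sq_complex hb]; positivity

lemma cGaussDensity_eq (v : ℝ) :
    cGaussDensity v = fun z => 1 / (Real.pi * v) * Real.exp (-v⁻¹ * ‖z‖ ^ 2) := by
  funext z; unfold cGaussDensity; congr 2; ring

lemma integral_cGauss {E : Type*} [NormedAddCommGroup E] [NormedSpace ℝ E] {v : ℝ} (hv : 0 < v)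
    (g : ℂ → E) : ∫ z, g z ∂cGauss v = ∫ z, cGaussDensity v z • g z := by
  unfold cGauss
  rw [integral_withDensity_eq_integral_toReal_smul
    (measurable_cGaussDensity v).ennreal_ofReal (by simp)]
  simp_rw [ENNReal.toReal_ofReal (cGaussDensity_nonneg hv _)]

lemma integrable_cGauss_iff {E : Type*} [NormedAddCommGroup E] [NormedSpace ℝ E] {v : ℝ}
    (hv : 0 < v) (g : ℂ → E) :
    Integrable g (cGauss v) ↔ Integrable fun z => cGaussDensity v z • g z := by
  unfold cGauss
  rw [integrable_withDensity_iff_integrable_smul'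
    (measurable_cGaussDensity v).ennreal_ofReal (by simp)]
  simp_rw [ENNReal.toReal_ofReal (cGaussDensity_nonneg hv _)]

lemma isProbabilityMeasure_cGauss {v : ℝ} (hv : 0 < v) : IsProbabilityMeasure (cGauss v) := by
  constructor
  unfold cGauss
  rw [withDensity_apply _ MeasurableSet.univ, Measure.restrict_univ,
    ← ofReal_integral_eq_lintegral_ofReal]
  · rw [cGaussDensity_eq, integral_const_mul, integral_exp_neg_mul_sq_complex (by positivity)]
    rw [ENNReal.ofReal_eq_one]
    field_simp
  · rw [cGaussDensity_eq]
    exact (integrable_exp_neg_mul_sq_complex (by positivity)).const_mul _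
  · exact Eventually.of_forall (cGaussDensity_nonneg hv)

lemma integral_cexp_cGauss {v : ℝ} (hv : 0 < v) (t : ℂ) :
    ∫ z, Complex.exp (Complex.I * ((star t * z).re : ℂ)) ∂cGauss v
      = Complex.exp (-((v * ‖t‖ ^ 2 : ℝ) : ℂ) / 4) := by
  have hb : 0 < ((v⁻¹ : ℝ) : ℂ).re := by simpa using hv
  -- `Re (star t * z)` is the real inner product on `ℂ ≅ ℝ²`, so this is a planar Gaussian Fourier
  -- transform.
  have key := GaussianFourier.integral_cexp_neg_mul_sq_norm_add (V := ℂ) hb Complex.I t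
  rw [integral_cGauss hv, cGaussDensity_eq]
  have : ∀ z : ℂ, ((1 / (Real.pi * v) * Real.exp (-v⁻¹ * ‖z‖ ^ 2) : ℝ)) •
      Complex.exp (Complex.I * ((star t * z).re : ℂ))
      = ((1 / (Real.pi * v) : ℝ) : ℂ) *
        Complex.exp (-((v⁻¹ : ℝ) : ℂ) * ‖z‖ ^ 2 + Complex.I * (inner ℝ t z : ℝ)) := by
    intro z
    rw [Complex.real_smul, Complex.exp_add, Complex.inner]
    simp only [Complex.mul_re, Complex.conj_re, Complex.conj_im, RCLike.star_def]
    push_cast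
    ring_nf
  simp_rw [this]
  rw [integral_const_mul, key]
  have hv' : (v : ℂ) ≠ 0 := by exact_mod_cast hv.ne'
  have hp : (Real.pi : ℂ) ≠ 0 := by exact_mod_cast Real.pi_ne_zero
  rw [Complex.finrank_real_complex]
  have e1 : ((2 : ℕ) : ℂ) / 2 = 1 := by norm_num
  rw [e1, Complex.cpow_one, ← mul_assoc]
  have e2 : ((1 / (Real.pi * v) : ℝ) : ℂ) * (Real.pi / ((v⁻¹ : ℝ) : ℂ)) = 1 := by
    push_cast; field_simp
  rw [e2, one_mul, Complex.I_sq]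
  congr 1
  push_cast
  field_simp

lemma integral_sq_exp_neg_mul_sq_complex {b : ℝ} (hb : 0 < b) :
    ∫ z : ℂ, ‖z‖ ^ 2 * Real.exp (-b * ‖z‖ ^ 2) = Real.pi / b ^ 2 := by
  have := Complex.integral_rpow_mul_exp_neg_mul_rpow (p := 2) (q := 2) (b := b)
    (by norm_num) (by norm_num) hb
  simp only [Real.rpow_two] at this
  rw [this]
  have h2 : (2 + 2 : ℝ) / 2 = (1 : ℕ) + 1 := by norm_num
  rw [h2, Real.Gamma_nat_eq_factorial]
  have h3 : -((2 : ℝ) + 2) / 2 = -((2 : ℕ) : ℝ) := by norm_num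
  rw [h3, Real.rpow_neg hb.le, Real.rpow_natCast]
  simp only [Nat.factorial_one, Nat.cast_one]
  field_simp

lemma integral_sq_cGauss {v : ℝ} (hv : 0 < v) : ∫ z, ‖z‖ ^ 2 ∂cGauss v = v := by
  rw [integral_cGauss hv, cGaussDensity_eq]
  simp_rw [smul_eq_mul, mul_assoc, mul_comm (Real.exp _)]
  rw [integral_const_mul, integral_sq_exp_neg_mul_sq_complex (by positivity)]
  field_simp

lemma integrable_sq_cGauss {v : ℝ} (hv : 0 < v) : Integrable (fun z => ‖z‖ ^ 2) (cGauss v) := by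
  refine Integrable.of_integral_ne_zero ?_
  rw [integral_sq_cGauss hv]; exact hv.ne'

lemma cGaussDensity_one_mul_ratio (v : ℝ) (z : ℂ) :
    cGaussDensity 1 z * cGaussRatio v z = cGaussDensity v z := by
  unfold cGaussDensity cGaussRatio
  rw [show -‖z‖ ^ 2 / v = -‖z‖ ^ 2 / 1 + (‖z‖ ^ 2 - ‖z‖ ^ 2 / v) by ring, Real.exp_add]
  simp only [one_div, mul_inv, mul_one]
  ring

lemma cGauss_eq_withDensity_ratio (v : ℝ) :
    cGauss v = (cGauss 1).withDensity fun z => ENNReal.ofReal (cGaussRatio v z) := by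
  unfold cGauss
  rw [← withDensity_mul _ (measurable_cGaussDensity 1).ennreal_ofReal
    (measurable_cGaussRatio v).ennreal_ofReal]
  congr 1
  funext z
  rw [Pi.mul_apply, ← ENNReal.ofReal_mul (cGaussDensity_nonneg one_pos z),
    cGaussDensity_one_mul_ratio]

lemma integrable_cGaussRatio {v : ℝ} (hv : 0 < v) : Integrable (cGaussRatio v) (cGauss 1) := by
  rw [integrable_cGauss_iff one_pos]
  simp_rw [smul_eq_mul, cGaussDensity_one_mul_ratio]
  rw [cGaussDensity_eq]
  exact (integrable_exp_neg_mul_sq_complex (by positivity)).const_mul _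

/-- The geometric mean of the two densities is again an unnormalized Gaussian, whose precision is
the average `(1 + 1/v)/2` of the two precisions. -/
lemma integral_sqrt_cGaussRatio {v : ℝ} (hv : 0 < v) :
    ∫ z, √(cGaussRatio v z) ∂cGauss 1 = 2 * √v / (1 + v) := by
  rw [integral_cGauss one_pos]
  have : ∀ z, cGaussDensity 1 z • √(cGaussRatio v z)
      = (1 / (Real.pi * √v)) * Real.exp (-((1 + v) / (2 * v)) * ‖z‖ ^ 2) := by
    intro z
    unfold cGaussDensity cGaussRatio
    rw [Real.sqrt_mul (by positivity), ← Real.exp_half, smul_eq_mul, Real.sqrt_div zero_le_one]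
    rw [show -((1 + v) / (2 * v)) * ‖z‖ ^ 2
      = -‖z‖ ^ 2 / 1 + (‖z‖ ^ 2 - ‖z‖ ^ 2 / v) / 2 by field_simp; ring, Real.exp_add]
    simp only [one_div, mul_inv, mul_one, Real.sqrt_one]
    ring
  simp_rw [this]
  rw [integral_const_mul, integral_exp_neg_mul_sq_complex (by positivity)]
  have := Real.sqrt_pos.2 hv
  have h2 := Real.sq_sqrt hv.le
  field_simp
  rw [h2]

/-- `(affinity)⁻² = 1 + j / 4`, with `j` the Jeffreys divergence in dimension one. -/
lemma sq_affinity_eq {v : ℝ} (hv : 0 < v) :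
    (2 * √v / (1 + v)) ^ 2 = (1 + (v + 1 / v - 2) / 4)⁻¹ := by
  rw [div_pow, mul_pow, Real.sq_sqrt hv.le]
  have : (1 + (v + 1 / v - 2) / 4) = (1 + v) ^ 2 / (4 * v) := by field_simp; ring
  rw [this, inv_div]
  norm_num

/-! ### Bhattacharyya coefficient and error probabilities -/

section Affinity

variable {α : Type*} [MeasurableSpace α] {P Q : Measure α} {L : α → ℝ}

lemma measureReal_eq_setIntegral_of_withDensity (hL : Integrable L Q) (hL0 : ∀ x, 0 ≤ L x)
    (hP : P = Q.withDensity fun x => ENNReal.ofReal (L x)) {A : Set α} (hA : MeasurableSet A) :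
    P.real A = ∫ x in A, L x ∂Q := by
  rw [measureReal_def, hP, withDensity_apply _ hA, ← ofReal_integral_eq_lintegral_ofReal
    hL.integrableOn (Eventually.of_forall hL0), ENNReal.toReal_ofReal (integral_nonneg hL0)]

/-- The probability, under `P`, that the likelihood ratio `dP/dQ` is at most one is bounded by
the Bhattacharyya coefficient. -/
lemma measureReal_ratio_le_one_le (hm : Measurable L) (hL : Integrable L Q) (hL0 : ∀ x, 0 ≤ L x)
    (hP : P = Q.withDensity fun x => ENNReal.ofReal (L x))
    (hs : Integrable (fun x => √(L x)) Q) :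
    P.real {x | L x ≤ 1} ≤ ∫ x, √(L x) ∂Q := by
  have hA : MeasurableSet {x | L x ≤ 1} := measurableSet_le hm measurable_const
  rw [measureReal_eq_setIntegral_of_withDensity hL hL0 hP hA]
  calc ∫ x in {x | L x ≤ 1}, L x ∂Q ≤ ∫ x in {x | L x ≤ 1}, √(L x) ∂Q := by
        refine setIntegral_mono_on hL.integrableOn hs.integrableOn hA fun x hx => ?_
        -- For `0 ≤ L ≤ 1` one has `L² ≤ L`, hence `L ≤ √L`.
        exact Real.le_sqrt_of_sq_le (by nlinarith [hL0 x, show L x ≤ 1 from hx])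
    _ ≤ ∫ x, √(L x) ∂Q :=
        setIntegral_le_integral hs (Eventually.of_forall fun x => Real.sqrt_nonneg _)

variable [IsProbabilityMeasure P] [IsProbabilityMeasure Q]

/-- If some test separates `P` from `Q` well, then their Bhattacharyya coefficient is small. -/
lemma two_mul_affinity_le (hL : Integrable L Q) (hL0 : ∀ x, 0 ≤ L x)
    (hP : P = Q.withDensity fun x => ENNReal.ofReal (L x))
    (hs : Integrable (fun x => √(L x)) Q) {A : Set α} (hA : MeasurableSet A) {c : ℝ}
    (hc : 0 < c) :
    2 * ∫ x, √(L x) ∂Q ≤ c * (Q.real A + P.real Aᶜ) + 2 / c := by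
  -- Two weightings of AM-GM, used on `A` and on `Aᶜ` respectively. They put the factor `c` on the
  -- error masses `Q A` and `P Aᶜ`, and `1/c` on the other two masses, which are at most 1.
  have amgm : ∀ l : ℝ, 0 ≤ l → 2 * √l ≤ c + l / c := by
    intro l hl
    have h := Real.sq_sqrt hl
    rw [← sub_nonneg]
    have : c + l / c - 2 * √l = (c - √l) ^ 2 / c := by
      field_simp; nlinarith
    rw [this]; positivity
  have amgm' : ∀ l : ℝ, 0 ≤ l → 2 * √l ≤ c * l + 1 / c := by
    intro l hl
    have h := Real.sq_sqrt hl
    rw [← sub_nonneg]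
    have : c * l + 1 / c - 2 * √l = (c * √l - 1) ^ 2 / c := by
      field_simp; nlinarith
    rw [this]; positivity
  have h1 : ∫ x in A, 2 * √(L x) ∂Q ≤ c * Q.real A + P.real A / c := by
    calc ∫ x in A, 2 * √(L x) ∂Q ≤ ∫ x in A, (c + L x / c) ∂Q :=
          setIntegral_mono (hs.const_mul 2).integrableOn
            ((integrable_const c).add (hL.div_const c)).integrableOn fun x => amgm _ (hL0 x)
      _ = c * Q.real A + P.real A / c := by
          rw [integral_add (integrable_const c) (hL.div_const c).integrableOn, integral_div,
            ← measureReal_eq_setIntegral_of_withDensity hL hL0 hP hA]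
          simp [mul_comm]
  have h2 : ∫ x in Aᶜ, 2 * √(L x) ∂Q ≤ c * P.real Aᶜ + Q.real Aᶜ / c := by
    calc ∫ x in Aᶜ, 2 * √(L x) ∂Q ≤ ∫ x in Aᶜ, (c * L x + 1 / c) ∂Q :=
          setIntegral_mono (hs.const_mul 2).integrableOn
            ((hL.const_mul c).add (integrable_const (1 / c))).integrableOn
            fun x => amgm' _ (hL0 x)
      _ = c * P.real Aᶜ + Q.real Aᶜ / c := by
          rw [integral_add (hL.const_mul c).integrableOn (integrable_const _), integral_const_mul,
            ← measureReal_eq_setIntegral_of_withDensity hL hL0 hP hA.compl]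
          simp [div_eq_mul_inv]
  have h3 : P.real A / c ≤ 1 / c := by gcongr; exact measureReal_le_one
  have h4 : Q.real Aᶜ / c ≤ 1 / c := by gcongr; exact measureReal_le_one
  rw [← integral_const_mul, ← integral_add_compl hA (hs.const_mul 2)]
  have : 2 / c = 1 / c + 1 / c := by ring
  linarith

end Affinity

/-! ### Products of scalar Gaussians -/

section Product

variable {ι : Type*} [Fintype ι] {v : ι → ℝ}

/-- The law of independent circular complex normal variables with variances `v i`. -/
noncomputable def cGaussPi (v : ι → ℝ) : Measure (ι → ℂ) := Measure.pi fun i => cGauss (v i)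

lemma isProbabilityMeasure_cGaussPi (hv : ∀ i, 0 < v i) :
    IsProbabilityMeasure (cGaussPi v) := by
  have := fun i => isProbabilityMeasure_cGauss (hv i)
  unfold cGaussPi
  infer_instance

/-- The likelihood ratio of `cGaussPi v` against `cGaussPi 1`. -/
noncomputable def cGaussPiRatio (v : ι → ℝ) (x : ι → ℂ) : ℝ := ∏ i, cGaussRatio (v i) (x i)

lemma measurable_cGaussPiRatio (v : ι → ℝ) : Measurable (cGaussPiRatio v) :=
  Finset.measurable_prod _ fun i _ => (measurable_cGaussRatio (v i)).comp (measurable_pi_apply i)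

lemma cGaussPiRatio_nonneg (hv : ∀ i, 0 < v i) (x : ι → ℂ) : 0 ≤ cGaussPiRatio v x :=
  Finset.prod_nonneg fun i _ => (cGaussRatio_pos (hv i) _).le

lemma integrable_cGaussPiRatio (hv : ∀ i, 0 < v i) :
    Integrable (cGaussPiRatio v) (cGaussPi fun _ => 1) := by
  have := isProbabilityMeasure_cGauss one_pos
  exact Integrable.fintype_prod fun i => integrable_cGaussRatio (hv i)

lemma cGaussPi_eq_withDensity_ratio (hv : ∀ i, 0 < v i) :
    cGaussPi v = (cGaussPi fun _ => 1).withDensity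
      fun x => ENNReal.ofReal (cGaussPiRatio v x) := by
  have := isProbabilityMeasure_cGauss one_pos
  have := fun i => isProbabilityMeasure_cGauss (hv i)
  refine Measure.pi_eq fun s hs => ?_
  rw [withDensity_apply _ (MeasurableSet.univ_pi hs), cGaussPi, Measure.restrict_pi_pi,
    ← ofReal_integral_eq_lintegral_ofReal]
  · unfold cGaussPiRatio
    rw [integral_fintype_prod_eq_prod (fun i => cGaussRatio (v i)), ENNReal.ofReal_prod_of_nonneg]
    · refine Finset.prod_congr rfl fun i _ => ?_
      rw [cGauss_eq_withDensity_ratio (v i), withDensity_apply _ (hs i),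
        ofReal_integral_eq_lintegral_ofReal (integrable_cGaussRatio (hv i)).integrableOn
          (Eventually.of_forall fun z => (cGaussRatio_pos (hv i) z).le)]
    · exact fun i _ => integral_nonneg fun z => (cGaussRatio_pos (hv i) z).le
  · rw [← Measure.restrict_pi_pi]
    exact (integrable_cGaussPiRatio hv).integrableOn
  · exact Eventually.of_forall (cGaussPiRatio_nonneg hv)

lemma sqrt_cGaussPiRatio (hv : ∀ i, 0 < v i) (x : ι → ℂ) :
    √(cGaussPiRatio v x) = ∏ i, √(cGaussRatio (v i) (x i)) :=
  Real.sqrt_prod _ fun i _ => (cGaussRatio_pos (hv i) _).le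

lemma integral_sqrt_cGaussPiRatio (hv : ∀ i, 0 < v i) :
    ∫ x, √(cGaussPiRatio v x) ∂cGaussPi (fun _ => 1) = ∏ i, 2 * √(v i) / (1 + v i) := by
  have := isProbabilityMeasure_cGauss one_pos
  simp_rw [sqrt_cGaussPiRatio hv]
  unfold cGaussPi
  rw [integral_fintype_prod_eq_prod (fun i z => √(cGaussRatio (v i) z))]
  exact Finset.prod_congr rfl fun i _ => integral_sqrt_cGaussRatio (hv i)

lemma integrable_sqrt_cGaussPiRatio (hv : ∀ i, 0 < v i) :
    Integrable (fun x => √(cGaussPiRatio v x)) (cGaussPi fun _ => 1) := by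
  refine Integrable.of_integral_ne_zero ?_
  rw [integral_sqrt_cGaussPiRatio hv]
  exact Finset.prod_ne_zero_iff.2 fun i _ => by have := hv i; positivity

lemma integrable_sq_cGaussPi (hv : ∀ i, 0 < v i) (i : ι) :
    Integrable (fun x : ι → ℂ => ‖x i‖ ^ 2) (cGaussPi v) := by
  have := fun i => isProbabilityMeasure_cGauss (hv i)
  exact integrable_comp_eval (X := fun _ : ι => ℂ) (μ := fun i => cGauss (v i)) (i := i)
    (f := fun z : ℂ => ‖z‖ ^ 2) (integrable_sq_cGauss (hv i))

lemma integral_sq_cGaussPi (hv : ∀ i, 0 < v i) (i : ι) :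
    ∫ x : ι → ℂ, ‖x i‖ ^ 2 ∂cGaussPi v = v i := by
  have := fun i => isProbabilityMeasure_cGauss (hv i)
  unfold cGaussPi
  rw [integral_comp_eval (X := fun _ : ι => ℂ) (μ := fun i => cGauss (v i)) (i := i)
    (f := fun z : ℂ => ‖z‖ ^ 2) (by fun_prop), integral_sq_cGauss (hv i)]

lemma integral_cexp_cGaussPi (hv : ∀ i, 0 < v i) (t : ι → ℂ) :
    ∫ x, Complex.exp (Complex.I * ((star t ⬝ᵥ x).re : ℂ)) ∂cGaussPi v
      = Complex.exp (-((∑ i, v i * ‖t i‖ ^ 2 : ℝ) : ℂ) / 4) := by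
  have := fun i => isProbabilityMeasure_cGauss (hv i)
  simp_rw [dotProduct, Complex.re_sum, Complex.ofReal_sum, Finset.mul_sum, Complex.exp_sum]
  unfold cGaussPi
  rw [integral_fintype_prod_eq_prod
    (fun i z => Complex.exp (Complex.I * ((star t i * z).re : ℂ)))]
  rw [neg_div, Finset.sum_div, ← Finset.sum_neg_distrib, Complex.exp_sum]
  refine Finset.prod_congr rfl fun i _ => ?_
  rw [Pi.star_apply, integral_cexp_cGauss (hv i), neg_div]

lemma one_add_sum_le_prod_one_add {κ : Type*} (s : Finset κ) {f : κ → ℝ} (hf : ∀ i, 0 ≤ f i) :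
    1 + ∑ i ∈ s, f i ≤ ∏ i ∈ s, (1 + f i) := by
  classical
  induction s using Finset.induction_on with
  | empty => simp
  | insert a s ha ih =>
    rw [Finset.sum_insert ha, Finset.prod_insert ha]
    nlinarith [hf a, Finset.sum_nonneg fun i (_ : i ∈ s) => hf i]

/-- The Bhattacharyya coefficient `∏ 2 √v / (1 + v)` and the Jeffreys divergence
`∑ (v + 1 / v - 2)` control each other. -/
lemma sq_prod_affinity_le (hv : ∀ i, 0 < v i) :
    (∏ i, 2 * √(v i) / (1 + v i)) ^ 2 ≤ (1 + (∑ i, (v i + 1 / v i - 2)) / 4)⁻¹ := by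
  have h0 : ∀ i, 0 ≤ (v i + 1 / v i - 2) / 4 := fun i => by
    have := hv i
    rw [show v i + 1 / v i - 2 = (v i - 1) ^ 2 / v i by field_simp; ring]
    positivity
  rw [← Finset.prod_pow]
  simp_rw [fun i => sq_affinity_eq (hv i)]
  rw [Finset.prod_inv_distrib]
  have hs : 0 ≤ (∑ i, (v i + 1 / v i - 2)) / 4 := by
    rw [Finset.sum_div]; exact Finset.sum_nonneg fun i _ => h0 i
  gcongr
  rw [Finset.sum_div]
  -- Expanding `∏ (1 + j/4)` with nonnegative `j` and keeping only the constant and linear terms.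
  exact one_add_sum_le_prod_one_add _ h0

/-- The inequality `1 + x ≤ exp x` in each factor; no constant depends on the number of coordinates.
-/
lemma exp_le_sq_prod_affinity (hv : ∀ i, 0 < v i) :
    Real.exp (-(∑ i, (v i + 1 / v i - 2)) / 4) ≤ (∏ i, 2 * √(v i) / (1 + v i)) ^ 2 := by
  rw [← Finset.prod_pow]
  simp_rw [fun i => sq_affinity_eq (hv i)]
  rw [neg_div, Finset.sum_div, ← Finset.sum_neg_distrib, Real.exp_sum]
  refine Finset.prod_le_prod (fun i _ => (Real.exp_pos _).le) fun i _ => ?_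
  have := hv i
  rw [Real.exp_neg]
  have h0 : 0 ≤ v i + 1 / v i - 2 := by
    rw [show v i + 1 / v i - 2 = (v i - 1) ^ 2 / v i by field_simp; ring]
    positivity
  gcongr
  rw [add_comm]
  exact Real.add_one_le_exp _

end Product

/-! ### Uniqueness from characteristic functions -/

/-- Two laws on `ℂ^ι` with the same characteristic function agree. -/
lemma measure_ext_of_integral_cexp {ι : Type*} [Fintype ι] {μ ν : Measure (ι → ℂ)}
    [IsProbabilityMeasure μ] [IsProbabilityMeasure ν]
    (h : ∀ t : ι → ℂ, ∫ x, Complex.exp (Complex.I * ((star t ⬝ᵥ x).re : ℂ)) ∂μ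
      = ∫ x, Complex.exp (Complex.I * ((star t ⬝ᵥ x).re : ℂ)) ∂ν) : μ = ν := by
  classical
  refine Measure.ext_of_charFunDual (funext fun L => ?_)
  -- A real-linear functional on `ℂ^ι` is `x ↦ Re (tᴴ x)`; its values at `e_i` and `i e_i` are the
  -- real and imaginary parts of `t_i`.
  let t : ι → ℂ := fun i => ⟨L (Pi.single i 1), L (Pi.single i Complex.I)⟩
  have hL : ∀ x, L x = (star t ⬝ᵥ x).re := by
    intro x
    conv_lhs => rw [← Finset.univ_sum_single x]
    rw [map_sum, dotProduct, Complex.re_sum]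
    refine Finset.sum_congr rfl fun i _ => ?_
    have : (Pi.single i (x i) : ι → ℂ)
        = (x i).re • (Pi.single i 1 : ι → ℂ) + (x i).im • (Pi.single i Complex.I : ι → ℂ) := by
      rw [← Pi.single_smul, ← Pi.single_smul, ← Pi.single_add]
      congr 1
      simp [Complex.re_add_im]
    rw [this, map_add, map_smul, map_smul]
    simp [t, mul_comm]
  simp_rw [charFunDual_apply, hL, mul_comm _ Complex.I]
  exact h t

lemma measurable_mulVec {m n : Type*} [Countable m] [Fintype n] (T : Matrix m n ℂ) :
    Measurable (T *ᵥ · : (n → ℂ) → m → ℂ) :=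
  (Continuous.matrix_mulVec continuous_const continuous_id).measurable

/-! ### Congruence and diagonalization of covariances -/

section Matrices

variable {ι : Type*} [Fintype ι] [DecidableEq ι]

lemma Matrix.PosDef.exists_unitary_diagonal {A : Matrix ι ι ℂ} (hA : A.PosDef) :
    ∃ (U : Matrix ι ι ℂ) (v : ι → ℝ), (∀ i, 0 < v i) ∧ U * Uᴴ = 1 ∧
      A = U * Matrix.diagonal (fun i => (v i : ℂ)) * Uᴴ := by
  refine ⟨hA.1.eigenvectorUnitary, hA.1.eigenvalues, hA.eigenvalues_pos, ?_, ?_⟩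
  · exact Unitary.coe_mul_star_self hA.1.eigenvectorUnitary
  · have := hA.1.spectral_theorem
    rw [Unitary.conjStarAlgAut_apply] at this
    exact this

lemma Matrix.PosDef.exists_mul_conjTranspose {A : Matrix ι ι ℂ} (hA : A.PosDef) :
    ∃ T : Matrix ι ι ℂ, IsUnit T.det ∧ A = T * Tᴴ := by
  obtain ⟨U, v, hv, hU, h⟩ := hA.exists_unitary_diagonal
  have hT : A = (U * Matrix.diagonal fun i => (√(v i) : ℂ)) *
      (U * Matrix.diagonal fun i => (√(v i) : ℂ))ᴴ := by
    rw [Matrix.conjTranspose_mul, Matrix.diagonal_conjTranspose, Matrix.mul_assoc,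
      ← Matrix.mul_assoc (Matrix.diagonal _), Matrix.diagonal_mul_diagonal, ← Matrix.mul_assoc, h]
    congr! 4 with i
    rw [Pi.star_apply, RCLike.star_def, Complex.conj_ofReal, ← Complex.ofReal_mul,
      Real.mul_self_sqrt (hv i).le]
  refine ⟨_, ?_, hT⟩
  have hd : A.det ≠ 0 := hA.det_pos.ne'
  rw [hT, Matrix.det_mul] at hd
  exact (left_ne_zero_of_mul hd).isUnit

/-- Simultaneous diagonalization of two positive definite matrices by congruence. -/
lemma Matrix.PosDef.exists_simultaneous_diagonal {A B : Matrix ι ι ℂ} (hA : A.PosDef)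
    (hB : B.PosDef) : ∃ (T : Matrix ι ι ℂ) (v : ι → ℝ), IsUnit T.det ∧ (∀ i, 0 < v i) ∧
      A = T * Matrix.diagonal (fun i => (v i : ℂ)) * Tᴴ ∧ B = T * Tᴴ := by
  obtain ⟨R, hR, hBR⟩ := hB.exists_mul_conjTranspose
  have hR' : IsUnit R⁻¹ := (Matrix.isUnit_iff_isUnit_det _).2 (Matrix.isUnit_nonsing_inv_det _ hR)
  -- After whitening `B` by `R⁻¹`, a unitary `U` diagonalizes the transformed `A` and leaves the
  -- identity fixed, so `T = R * U` serves both.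
  have hA' : (R⁻¹ * A * (R⁻¹)ᴴ).PosDef :=
    hA.mul_mul_conjTranspose_same (Matrix.vecMul_injective_of_isUnit hR')
  obtain ⟨U, v, hv, hU, h⟩ := hA'.exists_unitary_diagonal
  refine ⟨R * U, v, ?_, hv, ?_, ?_⟩
  · rw [Matrix.det_mul]
    refine hR.mul ?_
    have := congrArg Matrix.det hU
    rw [Matrix.det_mul, Matrix.det_one] at this
    exact IsUnit.of_mul_eq_one _ this
  · have : R * (R⁻¹ * A * (R⁻¹)ᴴ) * Rᴴ = A := by
      rw [← Matrix.mul_assoc, ← Matrix.mul_assoc, Matrix.mul_nonsing_inv _ hR, Matrix.one_mul,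
        Matrix.mul_assoc, ← Matrix.conjTranspose_mul, Matrix.mul_nonsing_inv _ hR,
        Matrix.conjTranspose_one, Matrix.mul_one]
    rw [← this, h, Matrix.conjTranspose_mul]
    simp only [Matrix.mul_assoc]
  · rw [hBR, Matrix.conjTranspose_mul, Matrix.mul_assoc, ← Matrix.mul_assoc U, hU, Matrix.one_mul]

variable {T : Matrix ι ι ℂ} {v : ι → ℝ}

lemma inv_mul_diagonal_mul_conjTranspose (hv : ∀ i, 0 < v i) :
    (T * Matrix.diagonal (fun i => (v i : ℂ)) * Tᴴ)⁻¹
      = (Tᴴ)⁻¹ * Matrix.diagonal (fun i => ((v i)⁻¹ : ℂ)) * T⁻¹ := by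
  have : (Matrix.diagonal (fun i => (v i : ℂ)))⁻¹ = Matrix.diagonal (fun i => ((v i)⁻¹ : ℂ)) := by
    refine Matrix.inv_eq_right_inv ?_
    rw [Matrix.diagonal_mul_diagonal, ← Matrix.diagonal_one]
    congr! 2 with i
    exact mul_inv_cancel₀ (by exact_mod_cast (hv i).ne')
  rw [Matrix.mul_inv_rev, Matrix.mul_inv_rev, this, Matrix.mul_assoc]

/-- The density of `𝒞𝒩(0, T diag(v) Tᴴ)` in the coordinates given by `T`. -/
lemma complexNormalPDF_congruence (hT : IsUnit T.det) (hv : ∀ i, 0 < v i) (x : ι → ℂ) :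
    complexNormalPDF (T * Matrix.diagonal (fun i => (v i : ℂ)) * Tᴴ) (T *ᵥ x)
      = 1 / (Real.pi ^ Fintype.card ι * (Complex.normSq T.det * ∏ i, v i))
        * Real.exp (-∑ i, ‖x i‖ ^ 2 / v i) := by
  unfold complexNormalPDF
  congr 3
  · rw [Matrix.det_mul, Matrix.det_mul, Matrix.det_conjTranspose, Matrix.det_diagonal,
      mul_right_comm, RCLike.star_def, Complex.mul_conj, ← Complex.ofReal_prod,
      ← Complex.ofReal_mul, Complex.ofReal_re]
  · have hT' : IsUnit Tᴴ.det := by rw [Matrix.det_conjTranspose]; exact hT.star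
    rw [inv_mul_diagonal_mul_conjTranspose hv, Matrix.mulVec_mulVec, Matrix.mul_assoc,
      Matrix.nonsing_inv_mul _ hT, Matrix.mul_one, Matrix.star_mulVec, Matrix.dotProduct_mulVec,
      Matrix.vecMul_vecMul, ← Matrix.mul_assoc, Matrix.mul_nonsing_inv _ hT', Matrix.one_mul,
      ← Matrix.dotProduct_mulVec, dotProduct, Complex.re_sum]
    refine Finset.sum_congr rfl fun i _ => ?_
    rw [Matrix.mulVec_diagonal, Pi.star_apply, RCLike.star_def]
    have : (starRingEnd ℂ) (x i) * (((v i : ℂ))⁻¹ * x i) = ((‖x i‖ ^ 2 / v i : ℝ) : ℂ) := by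
      rw [mul_left_comm, Complex.conj_mul']
      push_cast
      ring
    rw [this, Complex.ofReal_re]

/-- By cyclicity of the trace `T` cancels, leaving the diagonal entries `(v - 1)(1 - 1/v) = v + 1/v
- 2`. -/
lemma trace_inv_sub_inv_mul_sub (hT : IsUnit T.det) (hv : ∀ i, 0 < v i) :
    Matrix.trace (((T * Tᴴ)⁻¹ - (T * Matrix.diagonal (fun i => (v i : ℂ)) * Tᴴ)⁻¹)
      * (T * Matrix.diagonal (fun i => (v i : ℂ)) * Tᴴ - T * Tᴴ))
      = ((∑ i, (v i + 1 / v i - 2) : ℝ) : ℂ) := by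
  have hT' : IsUnit Tᴴ.det := by rw [Matrix.det_conjTranspose]; exact hT.star
  have e1 : (T * Tᴴ)⁻¹ - (T * Matrix.diagonal (fun i => (v i : ℂ)) * Tᴴ)⁻¹
      = (Tᴴ)⁻¹ * Matrix.diagonal (fun i => 1 - (v i : ℂ)⁻¹) * T⁻¹ := by
    rw [inv_mul_diagonal_mul_conjTranspose hv, Matrix.mul_inv_rev, ← Matrix.diagonal_sub,
      Matrix.mul_sub, Matrix.sub_mul, Matrix.diagonal_one, Matrix.mul_one]
  have e2 : T * Matrix.diagonal (fun i => (v i : ℂ)) * Tᴴ - T * Tᴴ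
      = T * Matrix.diagonal (fun i => (v i - 1 : ℂ)) * Tᴴ := by
    rw [← Matrix.diagonal_sub, Matrix.mul_sub, Matrix.sub_mul, Matrix.diagonal_one, Matrix.mul_one]
  rw [e1, e2, Matrix.trace_mul_comm]
  have e3 : T * Matrix.diagonal (fun i => (v i - 1 : ℂ)) * Tᴴ *
      ((Tᴴ)⁻¹ * Matrix.diagonal (fun i => 1 - (v i : ℂ)⁻¹) * T⁻¹)
      = T * (Matrix.diagonal (fun i => (v i - 1 : ℂ)) *
        Matrix.diagonal (fun i => 1 - (v i : ℂ)⁻¹)) * T⁻¹ := by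
    simp only [Matrix.mul_assoc]
    rw [← Matrix.mul_assoc Tᴴ, Matrix.mul_nonsing_inv _ hT', Matrix.one_mul]
  rw [e3, Matrix.trace_mul_comm, ← Matrix.mul_assoc, Matrix.nonsing_inv_mul _ hT, Matrix.one_mul,
    Matrix.diagonal_mul_diagonal, Matrix.trace_diagonal]
  push_cast
  refine Finset.sum_congr rfl fun i _ => ?_
  have : (v i : ℂ) ≠ 0 := by exact_mod_cast (hv i).ne'
  field_simp
  ring

/-- A complex normal law with covariance `T diag(v) Tᴴ` is the image under `T` of a product law. -/
lemma IsComplexNormal.eq_map_cGaussPi {μ : Measure (ι → ℂ)} (hv : ∀ i, 0 < v i)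
    (hμ : IsComplexNormal (T * Matrix.diagonal (fun i => (v i : ℂ)) * Tᴴ) μ) :
    μ = (cGaussPi v).map (T *ᵥ ·) := by
  obtain ⟨-, hprob, hchar⟩ := hμ
  have := isProbabilityMeasure_cGaussPi hv
  have hmeas := measurable_mulVec T
  have := Measure.isProbabilityMeasure_map (μ := cGaussPi v) hmeas.aemeasurable
  -- Both characteristic functions depend on `t` only through `∑ v_i |(Tᴴ t)_i|²`.
  refine measure_ext_of_integral_cexp fun t => ?_
  rw [hchar, integral_map hmeas.aemeasurable
    (Continuous.aestronglyMeasurable (by unfold dotProduct; fun_prop))]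
  have : ∀ x, star t ⬝ᵥ (T *ᵥ x) = star (Tᴴ *ᵥ t) ⬝ᵥ x := fun x => by
    rw [Matrix.star_mulVec, Matrix.conjTranspose_conjTranspose, Matrix.dotProduct_mulVec]
  simp_rw [this]
  rw [integral_cexp_cGaussPi hv]
  congr 3
  rw [← Matrix.mulVec_mulVec, ← Matrix.mulVec_mulVec, this, dotProduct, Complex.ofReal_sum]
  refine Finset.sum_congr rfl fun i _ => ?_
  rw [Matrix.mulVec_diagonal, Pi.star_apply, RCLike.star_def, mul_left_comm, Complex.conj_mul']
  push_cast
  rfl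

end Matrices

/-! ### Two Gaussian hypotheses -/

section Pair

variable {ι : Type*} [Fintype ι] [DecidableEq ι]

lemma mul_diagonal_one_mul_conjTranspose (T : Matrix ι ι ℂ) :
    T * Matrix.diagonal (fun _ => ((1 : ℝ) : ℂ)) * Tᴴ = T * Tᴴ := by
  simp

lemma complexNormalPDF_congruence_one_pos {T : Matrix ι ι ℂ} (hT : IsUnit T.det) (x : ι → ℂ) :
    0 < complexNormalPDF (T * Tᴴ) (T *ᵥ x) := by
  have hn : 0 < Complex.normSq T.det := Complex.normSq_pos.2 hT.ne_zero
  rw [← mul_diagonal_one_mul_conjTranspose,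
    complexNormalPDF_congruence (v := fun _ => 1) hT (fun _ => one_pos)]
  have := Real.pi_pos
  simp only [Finset.prod_const_one, mul_one]
  positivity

/-- Both densities share `π^n |det T|²`, so only the scalar ratios survive. This serves both the
comparison of likelihoods and the logarithm. -/
lemma complexNormalPDF_congruence_eq_ratio_mul {T : Matrix ι ι ℂ} {v : ι → ℝ} (hT : IsUnit T.det)
    (hv : ∀ i, 0 < v i) (x : ι → ℂ) :
    complexNormalPDF (T * Matrix.diagonal (fun i => (v i : ℂ)) * Tᴴ) (T *ᵥ x)
      = cGaussPiRatio v x * complexNormalPDF (T * Tᴴ) (T *ᵥ x) := by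
  rw [← mul_diagonal_one_mul_conjTranspose,
    complexNormalPDF_congruence (v := fun _ => 1) hT (fun _ => one_pos),
    complexNormalPDF_congruence hT hv]
  unfold cGaussPiRatio cGaussRatio
  rw [Finset.prod_mul_distrib, ← Real.exp_sum, Finset.sum_sub_distrib, sub_eq_add_neg,
    Real.exp_add]
  simp only [one_div, Finset.prod_const_one, mul_one, div_one, mul_inv, Finset.prod_inv_distrib]
  have : Real.exp (∑ i, ‖x i‖ ^ 2) * Real.exp (-∑ i, ‖x i‖ ^ 2) = 1 := by
    rw [← Real.exp_add, add_neg_cancel, Real.exp_zero]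
  linear_combination (-((Real.pi ^ Fintype.card ι)⁻¹ * (Complex.normSq T.det)⁻¹ * (∏ i, v i)⁻¹
    * Real.exp (-∑ i, ‖x i‖ ^ 2 / v i))) * this

lemma logLR_congruence {T : Matrix ι ι ℂ} {v : ι → ℝ} (hT : IsUnit T.det)
    (hv : ∀ i, 0 < v i) (x : ι → ℂ) :
    logLR (T * Matrix.diagonal (fun i => (v i : ℂ)) * Tᴴ) (T * Tᴴ) (T *ᵥ x)
      = ∑ i, (Real.log (1 / v i) + (1 - 1 / v i) * ‖x i‖ ^ 2) := by
  unfold logLR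
  rw [complexNormalPDF_congruence_eq_ratio_mul hT hv,
    mul_div_cancel_right₀ _ (complexNormalPDF_congruence_one_pos hT x).ne', cGaussPiRatio,
    Real.log_prod (fun i _ => (cGaussRatio_pos (hv i) _).ne')]
  refine Finset.sum_congr rfl fun i _ => ?_
  have := hv i
  rw [cGaussRatio, Real.log_mul (by positivity) (Real.exp_pos _).ne', Real.log_exp]
  ring

lemma measurable_complexNormalPDF (C : Matrix ι ι ℂ) : Measurable (complexNormalPDF C) := by
  unfold complexNormalPDF dotProduct Matrix.mulVec dotProduct
  fun_prop

lemma measurable_logLR (A B : Matrix ι ι ℂ) : Measurable (logLR A B) :=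
  Real.measurable_log.comp ((measurable_complexNormalPDF A).div (measurable_complexNormalPDF B))

/-- In the coordinates of `T` the log-likelihood ratio is affine in the `‖x i‖²`, so second moments
suffice. Keeping `w` apart from `v` covers both hypotheses, `w = v` and `w = 1`. -/
lemma integrable_logLR_map {T : Matrix ι ι ℂ} {v w : ι → ℝ} (hT : IsUnit T.det)
    (hv : ∀ i, 0 < v i) (hw : ∀ i, 0 < w i) :
    Integrable (logLR (T * Matrix.diagonal (fun i => (v i : ℂ)) * Tᴴ) (T * Tᴴ))
      ((cGaussPi w).map (T *ᵥ ·)) ∧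
    ∫ y, logLR (T * Matrix.diagonal (fun i => (v i : ℂ)) * Tᴴ) (T * Tᴴ) y
      ∂((cGaussPi w).map (T *ᵥ ·)) = ∑ i, (Real.log (1 / v i) + (1 - 1 / v i) * w i) := by
  have := isProbabilityMeasure_cGaussPi hw
  have hi : ∀ i, Integrable
      (fun x : ι → ℂ => Real.log (1 / v i) + (1 - 1 / v i) * ‖x i‖ ^ 2) (cGaussPi w) := fun i =>
    (integrable_const _).add ((integrable_sq_cGaussPi hw i).const_mul _)
  have hm := measurable_logLR (T * Matrix.diagonal (fun i => (v i : ℂ)) * Tᴴ) (T * Tᴴ)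
  constructor
  · rw [integrable_map_measure hm.aestronglyMeasurable (measurable_mulVec T).aemeasurable]
    unfold Function.comp
    simp_rw [logLR_congruence hT hv]
    exact integrable_finsetSum _ fun i _ => hi i
  · rw [integral_map (measurable_mulVec T).aemeasurable hm.aestronglyMeasurable]
    simp_rw [logLR_congruence hT hv]
    rw [integral_finsetSum _ fun i _ => hi i]
    refine Finset.sum_congr rfl fun i _ => ?_
    rw [integral_add (integrable_const _) ((integrable_sq_cGaussPi hw i).const_mul _),
      integral_const_mul, integral_sq_cGaussPi hw]
    simp

/-- For two nondegenerate complex normal laws, the log-likelihood ratio is integrable, the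
Jeffreys divergence `J` is given by a trace, and the Bhattacharyya coefficient `ρ`, which controls
the performance of tests between the two laws, is squeezed between functions of `J`. -/
theorem exists_jeffreys_affinity {A B : Matrix ι ι ℂ} (hA : A.PosDef) (hB : B.PosDef)
    {μ ν : Measure (ι → ℂ)} (hμ : IsComplexNormal A μ) (hν : IsComplexNormal B ν) :
    Integrable (logLR A B) μ ∧ Integrable (logLR A B) ν ∧
    ∃ J ρ : ℝ, ∫ y, logLR A B y ∂μ - ∫ y, logLR A B y ∂ν = J ∧
      (J : ℂ) = Matrix.trace ((B⁻¹ - A⁻¹) * (A - B)) ∧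
      0 ≤ ρ ∧ ρ ^ 2 ≤ (1 + J / 4)⁻¹ ∧ Real.exp (-J / 4) ≤ ρ ^ 2 ∧
      μ.real {y | complexNormalPDF A y ≤ complexNormalPDF B y} ≤ ρ ∧
      ∀ s, MeasurableSet s → ∀ c, 0 < c → 2 * ρ ≤ c * (ν.real s + μ.real sᶜ) + 2 / c := by
  obtain ⟨T, v, hT, hv, rfl, rfl⟩ := hA.exists_simultaneous_diagonal hB
  have h1 : ∀ i : ι, (0 : ℝ) < (fun _ => 1 : ι → ℝ) i := fun _ => one_pos
  have hP := isProbabilityMeasure_cGaussPi hv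
  have hQ := isProbabilityMeasure_cGaussPi h1
  rw [← mul_diagonal_one_mul_conjTranspose] at hν
  obtain rfl := hμ.eq_map_cGaussPi hv
  obtain rfl := hν.eq_map_cGaussPi h1
  have hmT := measurable_mulVec T
  obtain ⟨hi1, he1⟩ := integrable_logLR_map hT hv hv
  obtain ⟨hi2, he2⟩ := integrable_logLR_map hT hv h1
  refine ⟨hi1, hi2, ∑ i, (v i + 1 / v i - 2), ∏ i, 2 * √(v i) / (1 + v i), ?_, ?_, ?_,
    sq_prod_affinity_le hv, exp_le_sq_prod_affinity hv, ?_, ?_⟩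
  -- The logarithmic terms cancel between the two expectations.
  · rw [he1, he2, ← Finset.sum_sub_distrib]
    refine Finset.sum_congr rfl fun i _ => ?_
    have := (hv i).ne'
    field_simp
    ring
  · exact (trace_inv_sub_inv_mul_sub hT hv).symm
  · exact Finset.prod_nonneg fun i _ => by have := hv i; positivity
  · rw [map_measureReal_apply hmT (measurableSet_le (measurable_complexNormalPDF _)
      (measurable_complexNormalPDF _)), ← integral_sqrt_cGaussPiRatio hv]
    convert measureReal_ratio_le_one_le (measurable_cGaussPiRatio v) (integrable_cGaussPiRatio hv)
      (cGaussPiRatio_nonneg hv) (cGaussPi_eq_withDensity_ratio hv)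
      (integrable_sqrt_cGaussPiRatio hv) using 2
    ext x
    simp only [Set.mem_preimage, Set.mem_ofPred_eq]
    rw [complexNormalPDF_congruence_eq_ratio_mul hT hv,
      mul_le_iff_le_one_left (complexNormalPDF_congruence_one_pos hT x)]
  · intro s hs c hc
    rw [map_measureReal_apply hmT hs, map_measureReal_apply hmT hs.compl,
      ← integral_sqrt_cGaussPiRatio hv]
    exact two_mul_affinity_le (integrable_cGaussPiRatio hv)
      (cGaussPiRatio_nonneg hv) (cGaussPi_eq_withDensity_ratio hv)
      (integrable_sqrt_cGaussPiRatio hv) (hmT hs) hc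

end Pair

/-! ### Conditional law of the received signal -/

section Channel

variable {Ω : Type*} {K Nt N M : ℕ}
  {msg : Ω → Fin M} {H : Ω → Matrix (Fin Nt) (Fin N) ℂ} {Z : Ω → Matrix (Fin K) (Fin N) ℂ}
  {Ch : Matrix (Fin N × Fin Nt) (Fin N × Fin Nt) ℂ}
  {Cz : Matrix (Fin N × Fin K) (Fin N × Fin K) ℂ} {PZ : ℝ}

lemma rxSignal_apply (X : Fin M → Matrix (Fin K) (Fin Nt) ℂ) (ω : Ω) :
    rxSignal X msg H Z ω = ((1 : Matrix (Fin N) (Fin N) ℂ) ⊗ₖ X (msg ω)) *ᵥ Matrix.vec (H ω)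
      + Matrix.vec (Z ω) := by
  rw [rxSignal, Matrix.vec_add, Matrix.vec_mul_eq_mulVec]

lemma posDef_rxCov (hCh : Ch.PosSemidef) (hCz : Cz.PosDef) (X : Matrix (Fin K) (Fin Nt) ℂ) :
    (rxCov X Ch Cz).PosDef :=
  Matrix.PosDef.posSemidef_add (hCh.mul_mul_conjTranspose_same _) hCz

lemma star_dotProduct_mul_mul_conjTranspose {m n : Type*} [Fintype m] [Fintype n]
    (A : Matrix m n ℂ) (C : Matrix n n ℂ) (t : m → ℂ) :
    star t ⬝ᵥ ((A * C * Aᴴ) *ᵥ t) = star (Aᴴ *ᵥ t) ⬝ᵥ (C *ᵥ (Aᴴ *ᵥ t)) := by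
  rw [Matrix.star_mulVec, Matrix.conjTranspose_conjTranspose, ← Matrix.mulVec_mulVec,
    ← Matrix.mulVec_mulVec, Matrix.dotProduct_mulVec]

namespace IsFadingChannel

variable [MeasurableSpace Ω] {P : Measure Ω} (h : IsFadingChannel P msg H Z Ch Cz PZ)

include h

lemma measurable_rxSignal (X : Fin M → Matrix (Fin K) (Fin Nt) ℂ) :
    Measurable (rxSignal X msg H Z) := by
  have hH := h.measurable_H
  have hZ := h.measurable_Z
  refine measurable_pi_lambda _ fun p => ?_
  simp_rw [rxSignal_apply, Pi.add_apply, Matrix.mulVec, dotProduct]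
  refine Measurable.add (Finset.measurable_sum _ fun q _ => Measurable.mul ?_ ?_) ?_
  · exact (Measurable.of_discrete (f := fun a : Fin M =>
      ((1 : Matrix (Fin N) (Fin N) ℂ) ⊗ₖ X a) p q)).comp h.measurable_msg
  · exact (measurable_pi_apply q).comp hH
  · exact (measurable_pi_apply p).comp hZ

/-- Conditioning on a null event would yield the zero measure; the uniform prior excludes this. -/
lemma measure_msg_ne_zero (a : Fin M) : P (msg ⁻¹' {a}) ≠ 0 := by
  have hM : (0 : ℝ) < M := by exact_mod_cast Fin.pos a
  intro h0
  have := h.equiprobable a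
  rw [measureReal_def, h0, ENNReal.toReal_zero] at this
  exact (by positivity : (1 / M : ℝ) ≠ 0) this.symm

variable [IsProbabilityMeasure P]

/-- The message is independent of the pair `(H, Z)` jointly, so conditioning on it leaves their
joint law unchanged. -/
lemma map_cond (a : Fin M) :
    (cond P (msg ⁻¹' {a})).map (fun ω => (Matrix.vec (H ω), Matrix.vec (Z ω)))
      = P.map fun ω => (Matrix.vec (H ω), Matrix.vec (Z ω)) := by
  have hm := h.measurable_H.prodMk h.measurable_Z
  have ha := h.measurable_msg (measurableSet_singleton a)
  ext s hs
  rw [Measure.map_apply hm hs, Measure.map_apply hm hs, cond_apply ha,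
    h.indep_msg.measure_inter_preimage_eq_mul _ _ (measurableSet_singleton a) hs, ← mul_assoc,
    ENNReal.inv_mul_cancel (h.measure_msg_ne_zero a) (measure_ne_top _ _), one_mul]

/-- Given the message, the received signal is complex normal. -/
lemma isComplexNormal_rxSignal (X : Fin M → Matrix (Fin K) (Fin Nt) ℂ) (a : Fin M) :
    IsComplexNormal (rxCov (X a) Ch Cz)
      ((cond P (msg ⁻¹' {a})).map (rxSignal X msg H Z)) := by
  have hprob := cond_isProbabilityMeasure (h.measure_msg_ne_zero a)
  have hy := h.measurable_rxSignal X
  refine ⟨(posDef_rxCov h.law_H.1 h.posDef_Cz (X a)).posSemidef,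
    Measure.isProbabilityMeasure_map hy.aemeasurable, fun t => ?_⟩
  set A := (1 : Matrix (Fin N) (Fin N) ℂ) ⊗ₖ X a with hA
  let g (n : ℕ) (s x : Fin N × Fin n → ℂ) : ℂ := Complex.exp (Complex.I * ((star s ⬝ᵥ x).re : ℂ))
  have hg : ∀ n s, Continuous (g n s) := fun n s => by
    simp only [g, dotProduct]; fun_prop
  -- On this event the signal is `A h + z`, so its character splits into one factor in `h`, at
  -- frequency `Aᴴ t`, and one in `z`.
  have hsplit : ∀ ω ∈ msg ⁻¹' {a}, g K t (rxSignal X msg H Z ω)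
      = g Nt (Aᴴ *ᵥ t) (Matrix.vec (H ω)) * g K t (Matrix.vec (Z ω)) := by
    intro ω hω
    have hω : msg ω = a := hω
    simp only [g]
    rw [rxSignal_apply, hω, ← hA, dotProduct_add, Complex.add_re, Complex.ofReal_add, mul_add,
      Complex.exp_add, Matrix.star_mulVec, Matrix.conjTranspose_conjTranspose,
      Matrix.dotProduct_mulVec]
  have hm := h.measurable_H.prodMk h.measurable_Z
  have hG : AEStronglyMeasurable (fun p : (Fin N × Fin Nt → ℂ) × (Fin N × Fin K → ℂ) =>
      g Nt (Aᴴ *ᵥ t) p.1 * g K t p.2) (P.map fun ω => (Matrix.vec (H ω), Matrix.vec (Z ω))) :=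
    (((hg Nt _).comp continuous_fst).mul ((hg K _).comp continuous_snd)).aestronglyMeasurable
  calc ∫ x, g K t x ∂((cond P (msg ⁻¹' {a})).map (rxSignal X msg H Z))
      = ∫ ω, g K t (rxSignal X msg H Z ω) ∂cond P (msg ⁻¹' {a}) :=
        integral_map hy.aemeasurable (hg K t).aestronglyMeasurable
    _ = ∫ ω, g Nt (Aᴴ *ᵥ t) (Matrix.vec (H ω)) * g K t (Matrix.vec (Z ω))
          ∂cond P (msg ⁻¹' {a}) := by
        refine integral_congr_ae ?_
        filter_upwards [ae_cond_mem (h.measurable_msg (measurableSet_singleton a))] with ω hω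
        exact hsplit ω hω
    _ = ∫ ω, g Nt (Aᴴ *ᵥ t) (Matrix.vec (H ω)) * g K t (Matrix.vec (Z ω)) ∂P := by
        have hG' := hG
        rw [← h.map_cond a] at hG'
        refine (integral_map hm.aemeasurable hG').symm.trans ?_
        rw [h.map_cond a]
        exact integral_map hm.aemeasurable hG
    _ = (∫ ω, g Nt (Aᴴ *ᵥ t) (Matrix.vec (H ω)) ∂P) * ∫ ω, g K t (Matrix.vec (Z ω)) ∂P :=
        h.indep_H_Z.integral_fun_comp_mul_comp h.measurable_H.aemeasurable
          h.measurable_Z.aemeasurable (hg _ _).aestronglyMeasurable (hg _ _).aestronglyMeasurable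
    _ = _ := by
        rw [← integral_map h.measurable_H.aemeasurable (hg _ _).aestronglyMeasurable,
          ← integral_map h.measurable_Z.aemeasurable (hg _ _).aestronglyMeasurable]
        simp only [g]
        rw [h.law_H.2.2, h.law_Z.2.2, ← Complex.exp_add, rxCov, Matrix.add_mulVec, dotProduct_add,
          ← hA, star_dotProduct_mul_mul_conjTranspose]
        congr 1
        ring

/-- The law of total probability over the equiprobable messages. -/
lemma errorProb_eq (X : Fin M → Matrix (Fin K) (Fin Nt) ℂ)
    {d : (Fin N × Fin K → ℂ) → Fin M} (hd : Measurable d) :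
    errorProb P msg (rxSignal X msg H Z) d = ∑ a, 1 / (M : ℝ) *
      ((cond P (msg ⁻¹' {a})).map (rxSignal X msg H Z)).real {y | d y ≠ a} := by
  have hy := h.measurable_rxSignal X
  have hs : ∀ a, MeasurableSet {y | d y ≠ a} := fun a =>
    (hd (measurableSet_singleton a)).compl
  have hU : {ω | d (rxSignal X msg H Z ω) ≠ msg ω} = ⋃ a ∈ (Finset.univ : Finset (Fin M)),
      (msg ⁻¹' {a} ∩ rxSignal X msg H Z ⁻¹' {y | d y ≠ a}) := by
    ext ω
    simp
  rw [errorProb, hU, measureReal_biUnion_finset]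
  · refine Finset.sum_congr rfl fun a _ => ?_
    rw [map_measureReal_apply hy (hs a), ← h.equiprobable a, measureReal_def, measureReal_def,
      measureReal_def, ← ENNReal.toReal_mul, mul_comm,
      cond_mul_eq_inter (h.measurable_msg (measurableSet_singleton a))]
  · intro a _ b _ hab
    refine Set.disjoint_left.2 fun ω hωa hωb => hab ?_
    exact (show msg ω = a from hωa.1).symm.trans hωb.1
  · exact fun a _ => (h.measurable_msg (measurableSet_singleton a)).inter (hy (hs a))

end IsFadingChannel

end Channel

/-! ### Asymptotics and the main equivalence -/

/-- If, for every `c`, the quantity `2 ρ` is eventually at most `c ε + 2 / c` with `ε → 0`, and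
`ρ ^ 2` bounds `exp (-J / 4)`, then `J → ∞`. -/
lemma tendsto_atTop_of_affinity_le {J ρ ε : ℕ → ℝ} (hε : Tendsto ε atTop (𝓝 0))
    (h0 : ∀ᶠ n in atTop, 0 ≤ ρ n) (hJ : ∀ᶠ n in atTop, Real.exp (-J n / 4) ≤ ρ n ^ 2)
    (hρ : ∀ c, 0 < c → ∀ᶠ n in atTop, 2 * ρ n ≤ c * ε n + 2 / c) : Tendsto J atTop atTop := by
  refine tendsto_atTop.2 fun R => ?_
  -- Chosen so that `δ² = exp (-R/4)`. With `c = 2/δ` the term `2/c` is `δ` and `c ε` is eventually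
  -- below `δ`, whence `ρ ≤ δ`.
  set δ := Real.exp (-R / 8) with hδ
  have hδ0 : 0 < δ := Real.exp_pos _
  have hlim : Tendsto (fun n => 2 / δ * ε n) atTop (𝓝 0) := by simpa using hε.const_mul (2 / δ)
  filter_upwards [h0, hJ, hρ (2 / δ) (by positivity), hlim.eventually_lt_const hδ0]
    with n h0 hJ hρ hlt
  have h2 : 2 / (2 / δ) = δ := by field_simp
  have h3 : ρ n ≤ δ := by linarith
  have h4 : Real.exp (-J n / 4) ≤ Real.exp (-R / 4) := by
    calc Real.exp (-J n / 4) ≤ ρ n ^ 2 := hJ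
      _ ≤ δ ^ 2 := by gcongr
      _ = Real.exp (-R / 4) := by rw [hδ, ← Real.exp_nat_mul]; congr 1; push_cast; ring
  have := Real.exp_le_exp.1 h4
  linarith

theorem proposition1 {K Nt M : ℕ}
    -- the alphabet of `M` distinct codewords, with average power one
    (S : Fin M → Matrix (Fin K) (Fin Nt) ℂ) (hS : Function.Injective S)
    (hpower : 1 / (K : ℝ) * (1 / (M : ℝ) * ∑ a, frobSq (S a)) = 1)
    -- transmitted power and noise power
    (PX PZ : ℝ) (hPX : 0 < PX)
    -- for each number `N ≥ 1` of receive antennas: the channel, and a maximum likelihood detector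
    {Ω : ℕ → Type*} [∀ N, MeasurableSpace (Ω N)]
    (P : ∀ N, Measure (Ω N)) [∀ N, IsProbabilityMeasure (P N)]
    (msg : ∀ N, Ω N → Fin M)
    (H : ∀ N, Ω N → Matrix (Fin Nt) (Fin N) ℂ)
    (Z : ∀ N, Ω N → Matrix (Fin K) (Fin N) ℂ)
    (Ch : ∀ N, Matrix (Fin N × Fin Nt) (Fin N × Fin Nt) ℂ)
    (Cz : ∀ N, Matrix (Fin N × Fin K) (Fin N × Fin K) ℂ)
    (hmodel : ∀ N, 1 ≤ N → IsFadingChannel (P N) (msg N) (H N) (Z N) (Ch N) (Cz N) PZ)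
    (X : Fin M → Matrix (Fin K) (Fin Nt) ℂ) (hX : ∀ a, X a = txSignal PX (S a))
    (y : ∀ N, Ω N → Fin N × Fin K → ℂ) (hy : ∀ N, y N = rxSignal X (msg N) (H N) (Z N))
    (C : ∀ N, Fin M → Matrix (Fin N × Fin K) (Fin N × Fin K) ℂ)
    (hC : ∀ N a, C N a = rxCov (X a) (Ch N) (Cz N))
    (d : ∀ N, (Fin N × Fin K → ℂ) → Fin M)
    (hd : ∀ N, 1 ≤ N → IsMLDetector (C N) (d N)) :
    -- the Jeffreys divergences are well defined and given by the trace formula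
    (∀ N, 1 ≤ N → ∀ a b,
      Integrable (fun ω => logLR (C N a) (C N b) (y N ω)) (cond (P N) (msg N ⁻¹' {a})) ∧
      Integrable (fun ω => logLR (C N a) (C N b) (y N ω)) (cond (P N) (msg N ⁻¹' {b})) ∧
      (jeffreysDiv (P N) (msg N) (y N) (C N) a b : ℂ)
        = Matrix.trace (((C N b)⁻¹ - (C N a)⁻¹) * (C N a - C N b))) ∧
    -- the error probability vanishes if and only if all of them diverge
    (Tendsto (fun N => errorProb (P N) (msg N) (y N) (d N)) atTop (𝓝 0) ↔
      ∀ a b, a ≠ b →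
        Tendsto (fun N => jeffreysDiv (P N) (msg N) (y N) (C N) a b) atTop atTop) := by
  let μ (N : ℕ) (a : Fin M) := (cond (P N) (msg N ⁻¹' {a})).map (y N)
  have hyN : ∀ N, 1 ≤ N → Measurable (y N) := fun N hN => by
    rw [hy]; exact (hmodel N hN).measurable_rxSignal X
  have hμ : ∀ N, 1 ≤ N → ∀ a, IsComplexNormal (C N a) (μ N a) := fun N hN a => by
    simp only [μ]
    rw [hC, hy]; exact (hmodel N hN).isComplexNormal_rxSignal X a
  have hPD : ∀ N, 1 ≤ N → ∀ a, (C N a).PosDef := fun N hN a => by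
    rw [hC]; exact posDef_rxCov (hmodel N hN).law_H.1 (hmodel N hN).posDef_Cz _
  have hE : ∀ N, 1 ≤ N → errorProb (P N) (msg N) (y N) (d N)
      = ∑ a, 1 / (M : ℝ) * (μ N a).real {x | d N x ≠ a} := fun N hN => by
    simp only [μ]
    rw [hy]; exact (hmodel N hN).errorProb_eq X (hd N hN).1
  have hpair := fun N (hN : 1 ≤ N) a b =>
    exists_jeffreys_affinity (hPD N hN a) (hPD N hN b) (hμ N hN a) (hμ N hN b)
  have hJ : ∀ N, 1 ≤ N → ∀ a b, jeffreysDiv (P N) (msg N) (y N) (C N) a b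
      = ∫ x, logLR (C N a) (C N b) x ∂μ N a - ∫ x, logLR (C N a) (C N b) x ∂μ N b := by
    intro N hN a b
    have hm := (measurable_logLR (C N a) (C N b)).stronglyMeasurable
    simp only [jeffreysDiv, μ]
    rw [integral_map (hyN N hN).aemeasurable hm.aestronglyMeasurable,
      integral_map (hyN N hN).aemeasurable hm.aestronglyMeasurable]
  refine ⟨fun N hN a b => ?_, fun hlim a b hab => ?_, fun hlim => ?_⟩
  · obtain ⟨h1, h2, J, ρ, hJe, htr, -⟩ := hpair N hN a b
    exact ⟨h1.comp_measurable (hyN N hN), h2.comp_measurable (hyN N hN), by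
      rw [hJ N hN, hJe, htr]⟩
  · have hM : (0 : ℝ) < M := by exact_mod_cast Fin.pos a
    -- The chosen sequences are defined for every `N`, but controlled only for `N ≥ 1`; the value at
    -- `0` is irrelevant to the limit.
    choose! J ρ hJe _ h0 _ hexp _ htest using fun N (hN : 1 ≤ N) => (hpair N hN a b).2.2
    have hN : ∀ᶠ N : ℕ in atTop, 1 ≤ N := eventually_ge_atTop 1
    -- The test between `a` and `b` is the event that the detector returns `a`. Each of its two
    -- errors is at most a conditional error of the detector, hence at most `M` times the average
    -- error.
    refine tendsto_atTop_of_affinity_le (ρ := ρ) (ε := fun N => 2 * (M *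
      errorProb (P N) (msg N) (y N) (d N))) ?_ (hN.mono h0) ?_ ?_
    · simpa using (hlim.const_mul (M : ℝ)).const_mul 2
    · filter_upwards [hN] with N hN
      rw [hJ N hN, hJe N hN]
      exact hexp N hN
    · intro c hc
      filter_upwards [hN] with N hN
      have hle : ∀ e, (μ N e).real {x | d N x ≠ e}
          ≤ M * errorProb (P N) (msg N) (y N) (d N) := by
        intro e
        rw [hE N hN, ← Finset.mul_sum, ← mul_assoc, mul_one_div_cancel hM.ne', one_mul]
        exact Finset.single_le_sum (f := fun e => (μ N e).real {x | d N x ≠ e})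
          (fun _ _ => measureReal_nonneg) (Finset.mem_univ e)
      have := (hμ N hN b).2.1
      have hsub : (μ N b).real {x | d N x = a} ≤ (μ N b).real {x | d N x ≠ b} :=
        measureReal_mono fun x (hx : d N x = a) => show d N x ≠ b from hx ▸ hab
      have ht := htest N hN {x | d N x = a} ((hd N hN).1 (measurableSet_singleton a)) c hc
      refine ht.trans ?_
      gcongr
      have := hle a
      have := hle b
      have hcompl : {x | d N x = a}ᶜ = {x | d N x ≠ a} := rfl
      rw [hcompl]
      linarith
  · have hbound : ∀ᶠ N in atTop, errorProb (P N) (msg N) (y N) (d N) ≤ ∑ a, 1 / (M : ℝ) *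
        ∑ b ∈ Finset.univ.erase a, √((1 + jeffreysDiv (P N) (msg N) (y N) (C N) a b / 4)⁻¹) := by
      filter_upwards [eventually_ge_atTop 1] with N hN
      rw [hE N hN]
      gcongr with a
      have := (hμ N hN a).2.1
      -- A wrong decision `b = d N x` is itself a likelihood maximizer. The non-strict inequality
      -- includes ties, so their resolution does not matter.
      have hsub : {x | d N x ≠ a} ⊆ ⋃ b ∈ Finset.univ.erase a,
          {x | complexNormalPDF (C N a) x ≤ complexNormalPDF (C N b) x} := fun x hx =>
        Set.mem_biUnion (Finset.mem_coe.2 (Finset.mem_erase.2 ⟨hx, Finset.mem_univ _⟩))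
          ((hd N hN).2 x a)
      refine (measureReal_mono hsub (measure_ne_top _ _)).trans ((measureReal_biUnion_finset_le _ _).trans ?_)
      gcongr with b
      obtain ⟨-, -, J, ρ, hJe, -, h0, hle, -, herr, -⟩ := hpair N hN a b
      refine herr.trans (Real.le_sqrt_of_sq_le ?_)
      rw [hJ N hN, hJe]
      exact hle
    refine squeeze_zero' (Eventually.of_forall fun N => measureReal_nonneg) hbound ?_
    rw [show (0 : ℝ) = ∑ a : Fin M, 1 / (M : ℝ) * ∑ b ∈ Finset.univ.erase a, 0 by simp]
    refine tendsto_finsetSum _ fun a _ => (tendsto_finsetSum _ fun b hb => ?_).const_mul _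
    have hJinf := hlim a b (Finset.ne_of_mem_erase hb).symm
    have := (tendsto_atTop_add_const_left _ 1
      (hJinf.atTop_div_const (show (0 : ℝ) < 4 by norm_num))).inv_tendsto_atTop.sqrt
    simpa using this
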